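/- Let $p$ be a prime, $r\ge 1$, $q=p^r$, let $l$ be a prime with $l\neq 2$ and $l\neq p$, and let $k$ be a field with $\operatorname{char} k\neq l$. For $a\in\mathbb{F}_{q^2}$ put $\overline{a}=a^q$, and for a matrix $M$ over $\mathbb{F}_{q^2}$ let $\overline{M}$ be obtained by applying this to the entries. Let $n\ge 0$ and let $\beta$ be an invertible Hermitian $n\times n$ matrix over $\mathbb{F}_{q^2}$, that is, $\beta^T=\overline{\beta}$ and $\det\beta\neq 0$. Put $$U(n,q^2)=\{M\in GL_n(\mathbb{F}_{q^2}) : M^T\beta\overline{M}=\beta\},\qquad SU(n,q^2)=\{M\in U(n,q^2) : \det M=1\}.$$ For a finite group $G$ the essential $l$-dimension is $$\operatorname{ed}_k(G,l)=\sup_{F,\,t}\ \min_{F',\,E}\ \operatorname{trdeg}_k(E),$$ where $F$ runs over the field extensions of $k$ and $t$ over the $G$-torsors over $\operatorname{Spec}F$ (equivalently, Galois $G$-algebras over $F$), and the minimum is over all finite field extensions $F'/F$ with $l\nmid [F':F]$ and all intermediate fields $k\subseteq E\subseteq F'$ such that the base change of $t$ to $F'$ is isomorphic to the base change to $F'$ of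 some $G$-torsor over $\operatorname{Spec}E$. Then $$\operatorname{ed}_k(SU(n,q^2),l)=\begin{cases}\operatorname{ed}_k(U(n,q^2),l), & l\nmid q+1,\\ \operatorname{ed}_k(SL_n(\mathbb{F}_{q^2}),l), & l\mid q+1.\end{cases}$$ -/

import Mathlib

open scoped TensorProduct Matrix

universe u v

noncomputable section

/-- For an action `ρ` of `G` on a commutative `F`-algebra `L`, the canonical map
`L ⊗ L → ∏_{g ∈ G} L`, `a ⊗ b ↦ (a * ρ g b)_g`. On spectra it is the map
`G × X → X ×_F X` built from the action of `G` on `X = Spec L`. -/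
def torsorMap {G : Type v} [Group G] {F : Type u} [Field F] {L : Type u} [CommRing L]
    [Algebra F L] (ρ : G →* (L ≃ₐ[F] L)) : L ⊗[F] L →ₐ[F] (G → L) :=
  AlgHom.pi fun g =>
    Algebra.TensorProduct.productMap (AlgHom.id F L) (ρ g : L →ₐ[F] L)

/-- A `G`-torsor `Spec L → Spec F` for a finite group `G`, equivalently a Galois `G`-algebra `L`
over `F`: a nonzero commutative `F`-algebra with an action of `G` by `F`-algebra automorphisms for
which `L ⊗ L → ∏_{g ∈ G} L` is bijective. (Such an `L` is automatically étale of dimension `|G|`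
over `F`, with `F` as its ring of invariants.) -/
structure GTorsor (G : Type v) [Group G] (F : Type u) [Field F] where
  carrier : Type u
  [commRing : CommRing carrier]
  [algebra : Algebra F carrier]
  [nontrivial : Nontrivial carrier]
  action : G →* (carrier ≃ₐ[F] carrier)
  bijective : Function.Bijective (torsorMap action)

attribute [instance] GTorsor.commRing GTorsor.algebra GTorsor.nontrivial

/-- The action of `G` on the base change `F' ⊗ L` of a `G`-torsor `Spec L → Spec F` along `F → F'`:
`g` acts by `a ⊗ b ↦ a ⊗ g b`. -/
def GTorsor.baseChangeAction {G : Type v} [Group G] {F : Type u} [Field F] (t : GTorsor G F)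
    (F' : Type u) [Field F'] [Algebra F F'] (g : G) :
    (F' ⊗[F] t.carrier) →ₐ[F'] (F' ⊗[F] t.carrier) :=
  Algebra.TensorProduct.map (AlgHom.id F' F') (t.action g : t.carrier →ₐ[F] t.carrier)

/-- Let `t` be a `G`-torsor over `F`, and let `F → F'` and `E → F'` be field extensions. The image
of the class of `t` in `H¹(F'; G)` lies in the image of `H¹(E; G) → H¹(F'; G)`: some `G`-torsor
over `E` becomes isomorphic to `t` over `F'`. -/
def GTorsor.DescendsTo {G : Type v} [Group G] {F : Type u} [Field F] (t : GTorsor G F)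
    (F' : Type u) [Field F'] [Algebra F F'] (E : Type u) [Field E] [Algebra E F'] : Prop :=
  ∃ (t' : GTorsor G E) (e : (F' ⊗[F] t.carrier) ≃ₐ[F'] (F' ⊗[E] t'.carrier)),
    ∀ (g : G) (x : F' ⊗[F] t.carrier),
      e (t.baseChangeAction F' g x) = t'.baseChangeAction F' g (e x)

/-- The essential `l`-dimension `ed_k(t, l)` of a `G`-torsor `t` over a field `F ⊇ k`: the minimum
of `trdeg_k E` over all finite extensions `F'/F` of degree prime to `l` and all intermediate fields
`k ⊆ E ⊆ F'` such that `t` over `F'` descends to `E`. -/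
def GTorsor.essentialDim (k : Type u) [Field k] {G : Type v} [Group G] {F : Type u} [Field F]
    [Algebra k F] (t : GTorsor G F) (l : ℕ) : ℕ∞ :=
  ⨅ (F' : Type u) (_ : Field F') (_ : Algebra k F') (_ : Algebra F F') (_ : IsScalarTower k F F')
    (_ : FiniteDimensional F F') (_ : ¬ l ∣ Module.finrank F F')
    (E : IntermediateField k F') (_ : t.DescendsTo F' E),
    Cardinal.toENat (Algebra.trdeg k E)

/-- The essential `l`-dimension `ed_k(G, l)` of a finite group `G`: the supremum of `ed_k(t, l)`
over all field extensions `F/k` and all `G`-torsors `t` over `F`. -/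
def essentialDim (k : Type u) [Field k] (G : Type v) [Group G] (l : ℕ) : ℕ∞ :=
  ⨆ (F : Type u) (_ : Field F) (_ : Algebra k F) (t : GTorsor G F), t.essentialDim k l

/-- The unitary group `{M ∈ GL_n(R) : Mᵀ β (σ M) = β}` of the matrix `β`, where `σ` is a ring
endomorphism applied to the entries of `M`. -/
def matUnitary {n : ℕ} {R : Type v} [CommRing R] (σ : R →+* R)
    (β : Matrix (Fin n) (Fin n) R) : Subgroup (GL (Fin n) R) where
  carrier := {M | (M : Matrix (Fin n) (Fin n) R)ᵀ * β *
    (M : Matrix (Fin n) (Fin n) R).map σ = β}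
  one_mem' := by simp
  mul_mem' := by
    intro A B hA hB
    simp only [Set.mem_ofPred_eq, Units.val_mul, Matrix.transpose_mul, Matrix.map_mul] at hA hB ⊢
    calc _ = (B : Matrix (Fin n) (Fin n) R)ᵀ * ((A : Matrix (Fin n) (Fin n) R)ᵀ * β *
            (A : Matrix (Fin n) (Fin n) R).map σ) * (B : Matrix (Fin n) (Fin n) R).map σ := by
          simp only [Matrix.mul_assoc]
      _ = β := by rw [hA, hB]
  inv_mem' := by
    intro A hA
    simp only [Set.mem_ofPred_eq] at hA ⊢
    have h1 : (A : Matrix (Fin n) (Fin n) R) * ((A⁻¹ : GL (Fin n) R) : Matrix _ _ R) = 1 := by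
      rw [← Units.val_mul, mul_inv_cancel, Units.val_one]
    have h2 : ((A⁻¹ : GL (Fin n) R) : Matrix _ _ R)ᵀ * (A : Matrix (Fin n) (Fin n) R)ᵀ = 1 := by
      rw [← Matrix.transpose_mul, h1, Matrix.transpose_one]
    have h3 : (A : Matrix (Fin n) (Fin n) R).map σ *
        ((A⁻¹ : GL (Fin n) R) : Matrix (Fin n) (Fin n) R).map σ = 1 := by
      rw [← Matrix.map_mul, h1]; simp
    calc _ = ((A⁻¹ : GL (Fin n) R) : Matrix (Fin n) (Fin n) R)ᵀ *
            ((A : Matrix (Fin n) (Fin n) R)ᵀ * β * (A : Matrix (Fin n) (Fin n) R).map σ) *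
            ((A⁻¹ : GL (Fin n) R) : Matrix (Fin n) (Fin n) R).map σ := by rw [hA]
      _ = (((A⁻¹ : GL (Fin n) R) : Matrix (Fin n) (Fin n) R)ᵀ *
            (A : Matrix (Fin n) (Fin n) R)ᵀ) * β * ((A : Matrix (Fin n) (Fin n) R).map σ *
            ((A⁻¹ : GL (Fin n) R) : Matrix (Fin n) (Fin n) R).map σ) := by
          simp only [Matrix.mul_assoc]
      _ = β := by rw [h2, h3, Matrix.one_mul, Matrix.mul_one]

/-- The special unitary group: the elements of determinant `1` of the unitary group of `β`. -/
def matSpecialUnitary {n : ℕ} {R : Type v} [CommRing R] (σ : R →+* R)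
    (β : Matrix (Fin n) (Fin n) R) : Subgroup (GL (Fin n) R) :=
  matUnitary σ β ⊓ (Matrix.GeneralLinearGroup.det (n := Fin n) (R := R)).ker

end

/-! A subgroup `H` of a finite group `G` of index prime to `l` has the same essential `l`-dimension.
Given an `H`-torsor `t`, if the induced `G`-torsor descends to a field `E`, then `t` descends to a
finite extension of `E`, because the reduction to `H` is cut out by the image of the `G`-torsor over
`E`; so `ed H ≤ ed G`. Conversely, the `H`-invariants of a `G`-torsor over `F` form a product of
field extensions of `F` whose degrees add up to `[G : H]`; one of these degrees is prime to `l`, and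
over this extension the torsor is induced from `H`.

If `l ∤ q + 1`, this applies to `SU ≤ U`, because determinants of unitary matrices satisfy
`d ^ (q + 1) = 1`. If `l ∣ q + 1`, it applies to `SU ≤ SL`: the index divides `[GL : U]`, and `U`
contains a conjugate of the group `μ_{q + 1} ≀ S_n` of monomial matrices, since every nondegenerate
Hermitian form over a finite field has an orthonormal basis. As `l` is odd, lifting the exponent
shows that the orders of this monomial group and of `GL` have the same `l`-adic valuation.
-/

noncomputable section

section GaloisAction

/-- A Galois coordinate system `a, b` for an action `ρ` of `G` on `L`, in the sense of
Chase, Harrison and Rosenberg: `∑ i, a i * ρ g (b i)` is `1` for `g = 1` and `0` otherwise. -/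
structure IsGaloisCoordinates {G R L ι : Type*} [Group G] [CommRing R] [CommRing L] [Algebra R L]
    [Fintype ι] (ρ : G →* (L ≃ₐ[R] L)) (a b : ι → L) : Prop where
  sum_mul : ∑ i, a i * b i = 1
  sum_mul_apply : ∀ g, g ≠ 1 → ∑ i, a i * ρ g (b i) = 0

/-- An action of `G` on an `R`-algebra `L` makes `L` a Galois algebra over `R`: the invariants are
the image of `R`, and there is a Galois coordinate system. The map `R → L` need not be injective;
the lemmas that need this assume `FaithfulSMul R L`. -/
structure IsGaloisAction {G R L : Type*} [Group G] [CommRing R] [CommRing L] [Algebra R L]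
    (ρ : G →* (L ≃ₐ[R] L)) : Prop where
  exists_algebraMap_eq : ∀ x, (∀ g, ρ g x = x) → ∃ r, algebraMap R L r = x
  exists_coordinates : ∃ (m : ℕ) (a b : Fin m → L), IsGaloisCoordinates ρ a b

/-- The trace of an action of a finite group, as a linear map to `L` rather than to `R`. -/
def galoisTrace {G R L : Type*} [Group G] [Fintype G] [CommRing R] [CommRing L] [Algebra R L]
    (ρ : G →* (L ≃ₐ[R] L)) : L →ₗ[R] L :=
  ∑ g, (ρ g).toLinearMap

variable {G R L : Type*} [Group G] [CommRing R] [CommRing L] [Algebra R L]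
  {ρ : G →* (L ≃ₐ[R] L)}

section Trace

variable [Fintype G]

theorem galoisTrace_apply (x : L) : galoisTrace ρ x = ∑ g, ρ g x := by
  simp [galoisTrace]

theorem apply_galoisTrace (h : G) (x : L) : ρ h (galoisTrace ρ x) = galoisTrace ρ x := by
  simp only [galoisTrace_apply, map_sum, ← AlgEquiv.mul_apply, ← map_mul]
  exact Equiv.sum_comp (Equiv.mulLeft h) fun g => ρ g x

theorem galoisTrace_mul_of_forall_apply_eq {y : L} (hy : ∀ g, ρ g y = y) (x : L) :
    galoisTrace ρ (x * y) = galoisTrace ρ x * y := by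
  simp only [galoisTrace_apply, map_mul, hy, Finset.sum_mul]

theorem map_galoisTrace {S M : Type*} [CommRing S] [CommRing M] [Algebra S M]
    {τ : G →* (M ≃ₐ[S] M)} (f : L →+* M) (hf : ∀ g x, f (ρ g x) = τ g (f x)) (x : L) :
    f (galoisTrace ρ x) = galoisTrace τ (f x) := by
  simp only [galoisTrace_apply, map_sum, hf]

end Trace

namespace IsGaloisCoordinates

variable {ι : Type*} [Fintype ι] {a b : ι → L}

theorem map {H S M : Type*} [Group H] [CommRing S] [CommRing M] [Algebra S M]
    {τ : H →* (M ≃ₐ[S] M)} (h : IsGaloisCoordinates ρ a b) {i : H →* G}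
    (hi : Function.Injective i) (f : L →+* M) (hf : ∀ g x, f (ρ (i g) x) = τ g (f x)) :
    IsGaloisCoordinates τ (fun j => f (a j)) fun j => f (b j) where
  sum_mul := by simp only [← map_mul, ← map_sum, h.sum_mul, map_one]
  sum_mul_apply g hg := by
    simp only [← hf, ← map_mul, ← map_sum]
    rw [h.sum_mul_apply _ ((map_ne_one_iff i hi).2 hg), map_zero]

theorem isGaloisAction (h : IsGaloisCoordinates ρ a b)
    (hρ : ∀ x, (∀ g, ρ g x = x) → ∃ r, algebraMap R L r = x) : IsGaloisAction ρ where
  exists_algebraMap_eq := hρ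
  exists_coordinates := by
    let e := Fintype.equivFin ι
    refine ⟨_, a ∘ e.symm, b ∘ e.symm, ?_, fun g hg => ?_⟩
    · exact (Equiv.sum_comp e.symm fun i => a i * b i).trans h.sum_mul
    · exact (Equiv.sum_comp e.symm fun i => a i * ρ g (b i)).trans (h.sum_mul_apply g hg)

theorem sum_apply_mul_apply [DecidableEq G] (h : IsGaloisCoordinates ρ a b) (g g' : G) :
    ∑ i, ρ g (a i) * ρ g' (b i) = if g = g' then 1 else 0 := by
  have key : ∑ i, ρ g (a i) * ρ g' (b i) = ρ g (∑ i, a i * ρ (g⁻¹ * g') (b i)) := by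
    simp only [map_sum, map_mul, ← AlgEquiv.mul_apply, map_inv, mul_inv_cancel_left]
  split_ifs with hg
  · rw [key, hg, inv_mul_cancel, map_one]
    simp only [AlgEquiv.one_apply, h.sum_mul, map_one]
  · rw [key, h.sum_mul_apply _ (by rwa [Ne, inv_mul_eq_one]), map_zero]

theorem sum_mul_galoisTrace [Fintype G] (h : IsGaloisCoordinates ρ a b) (x : L) :
    ∑ i, a i * galoisTrace ρ (b i * x) = x := by
  classical
  calc ∑ i, a i * galoisTrace ρ (b i * x) = ∑ g, (∑ i, a i * ρ g (b i)) * ρ g x := by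
        simp only [galoisTrace_apply, Finset.mul_sum, Finset.sum_mul, map_mul, mul_assoc]
        exact Finset.sum_comm
    _ = ∑ g, if 1 = g then ρ g x else 0 :=
        Finset.sum_congr rfl fun g _ => by
          simpa using congr($(h.sum_apply_mul_apply 1 g) * ρ g x)
    _ = x := by simp

end IsGaloisCoordinates

namespace IsGaloisAction

theorem exists_algebraMap_eq_galoisTrace [Fintype G] (h : IsGaloisAction ρ) (x : L) :
    ∃ r, algebraMap R L r = galoisTrace ρ x :=
  h.exists_algebraMap_eq _ fun g => apply_galoisTrace g x

theorem finite [Finite G] (h : IsGaloisAction ρ) : Module.Finite R L := by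
  cases nonempty_fintype G
  obtain ⟨m, a, b, hab⟩ := h.exists_coordinates
  choose t ht using h.exists_algebraMap_eq_galoisTrace
  refine Module.Finite.of_surjective (Fintype.linearCombination R a) fun x =>
    ⟨fun i => t (b i * x), ?_⟩
  simpa [Fintype.linearCombination_apply, Algebra.smul_def, ht, mul_comm] using
    hab.sum_mul_galoisTrace x

theorem eq_zero_of_forall_galoisTrace_mul_eq_zero [Fintype G] (h : IsGaloisAction ρ) {x : L}
    (hx : ∀ y, galoisTrace ρ (y * x) = 0) : x = 0 := by
  obtain ⟨m, a, b, hab⟩ := h.exists_coordinates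
  simpa [hx] using (hab.sum_mul_galoisTrace x).symm

theorem exists_galoisTrace_eq_one [Fintype G] [FaithfulSMul R L] (h : IsGaloisAction ρ) :
    ∃ x, galoisTrace ρ x = 1 := by
  -- The coordinates show `L = I L` for the trace ideal `I` of `R`, so Nakayama gives `I = R`.
  let I : Ideal R := (LinearMap.range (galoisTrace ρ)).comap (Algebra.linearMap R L)
  have hL : (⊤ : Submodule R L) ≤ I • ⊤ := fun x _ => by
    obtain ⟨m, a, b, hab⟩ := h.exists_coordinates
    rw [← hab.sum_mul_galoisTrace x]
    refine sum_mem fun i _ => ?_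
    obtain ⟨r, hr⟩ := h.exists_algebraMap_eq_galoisTrace (b i * x)
    rw [mul_comm, ← hr, ← Algebra.smul_def]
    exact Submodule.smul_mem_smul ⟨_, hr.symm⟩ trivial
  have := h.finite
  obtain ⟨r, hr, hr0⟩ := Submodule.exists_sub_one_mem_and_smul_eq_zero_of_fg_of_le_smul I ⊤
    Module.Finite.fg_top hL
  obtain rfl : r = 0 := FaithfulSMul.algebraMap_injective R L <| by
    rw [Algebra.algebraMap_eq_smul_one, hr0 1 trivial, map_zero]
  have hI : (1 : R) ∈ I := by simpa using hr
  simpa [I] using hI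

theorem isReduced [Finite G] [IsReduced R] [FaithfulSMul R L] (h : IsGaloisAction ρ) :
    IsReduced L := by
  cases nonempty_fintype G
  refine ⟨fun x hx => h.eq_zero_of_forall_galoisTrace_mul_eq_zero fun y => ?_⟩
  obtain ⟨r, hr⟩ := h.exists_algebraMap_eq_galoisTrace (y * x)
  have hnil : IsNilpotent (algebraMap R L r) := by
    rw [hr, galoisTrace_apply]
    exact isNilpotent_sum fun g _ => ((Commute.all y x).isNilpotent_mul_left hx).map (ρ g)
  rw [IsNilpotent.map_iff (FaithfulSMul.algebraMap_injective R L)] at hnil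
  rw [← hr, hnil.eq_zero, map_zero]

theorem bijective_of_equivariant [Finite G] {M : Type*} [CommRing M] [Algebra R M]
    [FaithfulSMul R M] {τ : G →* (M ≃ₐ[R] M)} (hρ : IsGaloisAction ρ) (hτ : IsGaloisAction τ)
    (f : L →ₐ[R] M) (hf : ∀ g x, f (ρ g x) = τ g (f x)) : Function.Bijective f := by
  cases nonempty_fintype G
  constructor
  · refine (injective_iff_map_eq_zero f).2 fun x hx => ?_
    refine hρ.eq_zero_of_forall_galoisTrace_mul_eq_zero fun y => ?_
    obtain ⟨r, hr⟩ := hρ.exists_algebraMap_eq_galoisTrace (y * x)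
    have hr0 : algebraMap R M r = 0 := by
      rw [← f.commutes, hr]
      exact (map_galoisTrace (τ := τ) (f : L →+* M) hf _).trans (by simp [hx])
    rw [← hr, (FaithfulSMul.algebraMap_eq_zero_iff R M).1 hr0, map_zero]
  · intro y
    obtain ⟨m, a, b, hab⟩ := hρ.exists_coordinates
    have hab' := hab.map (τ := τ) (i := .id G) Function.injective_id (f : L →+* M) hf
    choose t ht using hτ.exists_algebraMap_eq_galoisTrace
    refine ⟨∑ i, a i * algebraMap R L (t (f (b i) * y)), ?_⟩
    simpa [ht] using hab'.sum_mul_galoisTrace y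

end IsGaloisAction

/-- The base change of an action on `L` to an action on `S ⊗ L`. -/
def tensorAction (S : Type*) [CommRing S] [Algebra R S] (ρ : G →* (L ≃ₐ[R] L)) :
    G →* (S ⊗[R] L ≃ₐ[S] S ⊗[R] L) where
  toFun g := Algebra.TensorProduct.congr .refl (ρ g)
  map_one' := AlgEquiv.coe_toAlgHom_injective (by ext x; simp)
  map_mul' g h := AlgEquiv.coe_toAlgHom_injective (by ext x; simp)

theorem tensorAction_tmul (S : Type*) [CommRing S] [Algebra R S] (g : G) (s : S) (x : L) :
    tensorAction S ρ g (s ⊗ₜ x) = s ⊗ₜ ρ g x :=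
  rfl

theorem IsGaloisAction.baseChange [Finite G] [FaithfulSMul R L] (h : IsGaloisAction ρ)
    (S : Type*) [CommRing S] [Algebra R S] : IsGaloisAction (tensorAction S ρ) := by
  cases nonempty_fintype G
  obtain ⟨m, a, b, hab⟩ := h.exists_coordinates
  refine (hab.map (i := .id G) Function.injective_id
    (Algebra.TensorProduct.includeRight : L →ₐ[R] S ⊗[R] L).toRingHom
    fun g x => rfl).isGaloisAction fun z hz => ?_
  have trace_mem (z : S ⊗[R] L) :
      galoisTrace (tensorAction S ρ) z ∈ (Algebra.linearMap S (S ⊗[R] L)).range := by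
    induction z with
    | zero => simp
    | add x y hx hy => rw [map_add]; exact add_mem hx hy
    | tmul s x =>
      obtain ⟨r, hr⟩ := h.exists_algebraMap_eq_galoisTrace x
      refine ⟨r • s, ?_⟩
      rw [galoisTrace_apply] at hr
      simp only [galoisTrace_apply, tensorAction_tmul, ← TensorProduct.tmul_sum, ← hr]
      simp [Algebra.algebraMap_eq_smul_one r, TensorProduct.tmul_smul, TensorProduct.smul_tmul']
  obtain ⟨c, hc⟩ := h.exists_galoisTrace_eq_one
  obtain ⟨s, hs⟩ := trace_mem (1 ⊗ₜ c * z)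
  refine ⟨s, hs.trans ?_⟩
  rw [galoisTrace_mul_of_forall_apply_eq hz, galoisTrace_apply]
  simp only [tensorAction_tmul, ← TensorProduct.tmul_sum]
  rw [← galoisTrace_apply, hc, ← Algebra.TensorProduct.one_def, one_mul]

/-- The action of `G` on functions `G → A` by right translation. -/
def translationAction (G R A : Type*) [Group G] [CommRing R] [CommRing A] [Algebra R A] :
    G →* ((G → A) ≃ₐ[R] (G → A)) where
  toFun g := .ofLinearEquiv (.funCongrLeft R A (Equiv.mulRight g)) rfl fun _ _ => rfl
  map_one' := by ext f x; exact congrArg f (mul_one x)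
  map_mul' g h := by ext f x; exact congrArg f (mul_assoc x g h).symm

theorem translationAction_apply (G R A : Type*) [Group G] [CommRing R] [CommRing A] [Algebra R A]
    (g : G) (f : G → A) (x : G) : translationAction G R A g f x = f (x * g) :=
  rfl

theorem isGaloisAction_translationAction (G R : Type*) [Group G] [Finite G] [CommRing R] :
    IsGaloisAction (translationAction G R R) := by
  classical
  cases nonempty_fintype G
  have coords : IsGaloisCoordinates (translationAction G R R)
      (fun s => Pi.single s 1) fun s => Pi.single s 1 := by
    constructor
    · ext x
      simp [Pi.single_apply]
    · intro g hg
      ext x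
      simp [translationAction_apply, Pi.single_apply, hg]
  refine coords.isGaloisAction fun f hf => ⟨f 1, ?_⟩
  ext x
  simpa [translationAction_apply] using (congrFun (hf x) 1).symm

end GaloisAction

section Torsor

variable {G : Type v} [Group G] {F L : Type u} [Field F] [CommRing L] [Algebra F L]
  {ρ : G →* (L ≃ₐ[F] L)}

theorem torsorMap_tmul (x y : L) (g : G) : torsorMap ρ (x ⊗ₜ y) g = x * ρ g y := by
  simp [torsorMap]

/-- The torsor of a Galois algebra over a field. -/
def IsGaloisAction.toGTorsor [Finite G] [Nontrivial L] (h : IsGaloisAction ρ) : GTorsor G F where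
  carrier := L
  action := ρ
  bijective := by
    -- `torsorMap ρ` is an equivariant map of Galois algebras over the ring `L`.
    let f : L ⊗[F] L →ₐ[L] (G → L) := AlgHom.pi fun g =>
      Algebra.TensorProduct.productLeftAlgHom (.id L L) (ρ g : L →ₐ[F] L)
    refine (h.baseChange L).bijective_of_equivariant (isGaloisAction_translationAction G L) f
      fun g z => ?_
    induction z with
    | zero => simp
    | add x y hx hy => simp only [map_add, hx, hy]
    | tmul x y =>
      ext g'
      simp [f, tensorAction_tmul, translationAction_apply]

namespace GTorsor

theorem isGaloisAction [Finite G] (t : GTorsor G F) : IsGaloisAction t.action := by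
  classical
  obtain ⟨z, hz⟩ := t.bijective.2 (Pi.single 1 1)
  obtain ⟨s, rfl⟩ := TensorProduct.exists_finset z
  have sum_eq (g : G) : ∑ i : s, i.1.1 * t.action g i.1.2 = (Pi.single 1 1 : G → t.carrier) g := by
    rw [← hz, map_sum, Finset.sum_apply, ← Finset.sum_coe_sort s]
    simp only [torsorMap_tmul]
  have coords : IsGaloisCoordinates t.action (fun i : s => i.1.1) fun i => i.1.2 :=
    ⟨by simpa using sum_eq 1, fun g hg => by simpa [hg] using sum_eq g⟩
  refine coords.isGaloisAction fun x hx => ?_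
  have tmul_comm : x ⊗ₜ[F] (1 : t.carrier) = 1 ⊗ₜ x := t.bijective.1 <| by
    ext g
    simpa [torsorMap_tmul] using (hx g).symm
  exact (Algebra.IsEffective.of_faithfullyFlat F t.carrier x).1 (sub_eq_zero.2 tmul_comm)

theorem isGaloisAction_baseChange [Finite G] (t : GTorsor G F) (F' : Type u) [Field F']
    [Algebra F F'] : IsGaloisAction (tensorAction F' t.action) :=
  t.isGaloisAction.baseChange F'

theorem finrank_eq_card [Finite G] (t : GTorsor G F) :
    Module.finrank F t.carrier = Nat.card G := by
  cases nonempty_fintype G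
  have := t.isGaloisAction.finite
  have h := (LinearEquiv.ofBijective (torsorMap t.action).toLinearMap t.bijective).finrank_eq
  rw [Module.finrank_tensorProduct, Module.finrank_pi_fintype, Finset.sum_const, smul_eq_mul,
    Finset.card_univ, ← Nat.card_eq_fintype_card] at h
  exact Nat.eq_of_mul_eq_mul_right Module.finrank_pos h

end GTorsor

end Torsor

section InvariantsAndInduction

section Restrict

variable {G R₀ R L : Type*} [Group G] [CommRing R₀] [CommRing R] [CommRing L] [Algebra R₀ R]
  [Algebra R L] [Algebra R₀ L] [IsScalarTower R₀ R L]

/-- The restriction of an action to a stable subalgebra, possibly over a smaller base ring. -/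
def restrictAction (ρ : G →* (L ≃ₐ[R] L)) (S : Subalgebra R₀ L)
    (hS : ∀ g, ∀ x ∈ S, ρ g x ∈ S) : G →* (S ≃ₐ[R₀] S) :=
  (AlgEquiv.algHomUnitsEquiv R₀ S).toMonoidHom.comp <| MonoidHom.toHomUnits
    { toFun := fun g =>
        ((((ρ g).restrictScalars R₀ : L ≃ₐ[R₀] L) : L →ₐ[R₀] L).comp S.val).codRestrict S
          fun x => hS g x x.2
      map_one' := by ext x; simp
      map_mul' := fun g h => by ext x; simp }

end Restrict

section Invariants

variable {G R L : Type*} [Group G] [CommRing R] [CommRing L] [Algebra R L]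

/-- The subalgebra of invariants of an action. -/
def invariants (ρ : G →* (L ≃ₐ[R] L)) : Subalgebra R L where
  carrier := {x | ∀ g, ρ g x = x}
  mul_mem' hx hy g := by rw [map_mul, hx g, hy g]
  add_mem' hx hy g := by rw [map_add, hx g, hy g]
  algebraMap_mem' r g := (ρ g).commutes r

/-- An action, viewed as an action over its subalgebra of invariants. -/
def invariantsAction (ρ : G →* (L ≃ₐ[R] L)) : G →* (L ≃ₐ[invariants ρ] L) where
  toFun g := { ρ g with commutes' := fun x => x.2 g }
  map_one' := by ext x; exact congr($(map_one ρ) x)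
  map_mul' g h := by ext x; exact congr($(map_mul ρ g h) x)

theorem IsGaloisCoordinates.isGaloisAction_invariantsAction {ι : Type*} [Fintype ι]
    {ρ : G →* (L ≃ₐ[R] L)} {a b : ι → L} (h : IsGaloisCoordinates ρ a b) :
    IsGaloisAction (invariantsAction ρ) :=
  (h.map (i := .id G) (τ := invariantsAction ρ) Function.injective_id (.id L)
    fun _ _ => rfl).isGaloisAction fun x hx => ⟨⟨x, hx⟩, rfl⟩

end Invariants

section Induced

variable {G H R C : Type*} [Group G] [Group H] [CommRing R] [CommRing C] [Algebra R C]
  (i : H →* G) (τ : H →* (C ≃ₐ[R] C))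

/-- The algebra induced along `i : H →* G`, as the functions `f : G → C` with
`f (i h * x) = τ h (f x)`. -/
def inducedAlgebra : Subalgebra R (G → C) where
  carrier := {f | ∀ h x, f (i h * x) = τ h (f x)}
  mul_mem' hf hf' h x := by simp only [Pi.mul_apply, hf h x, hf' h x, map_mul]
  add_mem' hf hf' h x := by simp only [Pi.add_apply, hf h x, hf' h x, map_add]
  algebraMap_mem' r h _ := ((τ h).commutes r).symm

/-- The action of `G` on an induced algebra by right translation. -/
def inducedAction : G →* (inducedAlgebra i τ ≃ₐ[R] inducedAlgebra i τ) :=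
  restrictAction (translationAction G R C) (inducedAlgebra i τ) fun g f hf h x => by
    simp only [translationAction_apply, mul_assoc, hf h (x * g)]

theorem inducedAction_apply (g x : G) (f : inducedAlgebra i τ) :
    (inducedAction i τ g f : G → C) x = (f : G → C) (x * g) :=
  rfl

/-- Evaluation at `1`, the counit of induction. -/
def inducedEval : inducedAlgebra i τ →ₐ[R] C :=
  (Pi.evalAlgHom R (fun _ : G => C) 1).comp (inducedAlgebra i τ).val

theorem inducedEval_inducedAction (h : H) (f : inducedAlgebra i τ) :
    inducedEval i τ (inducedAction i τ (i h) f) = τ h (inducedEval i τ f) := by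
  simpa [inducedEval, inducedAction_apply] using f.2 h 1

section Lift

variable {i τ} {R₀ L : Type*} [CommRing R₀] [CommRing L] [Algebra R₀ R]
  [Algebra R₀ C] [IsScalarTower R₀ R C] [Algebra R₀ L]
  {ρ : G →* (L ≃ₐ[R₀] L)}

/-- Frobenius reciprocity: an `H`-equivariant homomorphism from a `G`-algebra `L` to `C` lifts to
the algebra induced from `C`. -/
def inducedLift (f : L →ₐ[R₀] C) (hf : ∀ h x, f (ρ (i h) x) = τ h (f x)) :
    L →ₐ[R₀] inducedAlgebra i τ :=
  AlgHom.codRestrict (S := (inducedAlgebra i τ).restrictScalars R₀)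
    (AlgHom.pi fun g => f.comp (ρ g : L →ₐ[R₀] L)) fun y h x => by
      simpa using hf h (ρ x y)

theorem inducedLift_apply_apply (f : L →ₐ[R₀] C) (hf : ∀ h x, f (ρ (i h) x) = τ h (f x)) (g : G)
    (x : L) : inducedLift f hf (ρ g x) = inducedAction i τ g (inducedLift f hf x) := by
  ext x'
  change f (ρ x' (ρ g x)) = f (ρ (x' * g) x)
  rw [map_mul, AlgEquiv.mul_apply]

end Lift

section Single

variable [Fintype H]

open Classical in
/-- The element of the induced algebra supported on the coset `i H * s`, with values determined
by the translates of `c` (which are added up if `i` is not injective). -/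
def inducedSingle (s : G) (c : C) : inducedAlgebra i τ :=
  ⟨fun x => ∑ h, if x = i h * s then τ h c else 0, fun h x => by
    rw [map_sum]
    refine (Equiv.sum_comp (Equiv.mulLeft h) _).symm.trans (Finset.sum_congr rfl fun h' _ => ?_)
    rw [apply_ite (τ h), map_zero]
    simp [mul_assoc]⟩

open Classical in
theorem inducedSingle_apply (s x : G) (c : C) :
    (inducedSingle i τ s c : G → C) x = ∑ h, if x = i h * s then τ h c else 0 :=
  rfl

variable {i τ} in
open Classical in
theorem IsGaloisCoordinates.induced [Fintype G] {ι : Type*} [Fintype ι] {a b : ι → C}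
    (hab : IsGaloisCoordinates τ a b) {c : C} (hc : galoisTrace τ c = 1) :
    IsGaloisCoordinates (inducedAction i τ) (fun j : G × ι => inducedSingle i τ j.1 (c * a j.2))
      fun j => inducedSingle i τ j.1 (b j.2) := by
  have sum_single (s x y : G) :
      ∑ j, (inducedSingle i τ s (c * a j) : G → C) x * (inducedSingle i τ s (b j) : G → C) y =
        if x = y then ∑ h, if x = i h * s then τ h c else 0 else 0 := by
    calc _ = ∑ h, ∑ h', if x = i h * s ∧ y = i h' * s then
            τ h c * ∑ j, τ h (a j) * τ h' (b j) else 0 := by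
          simp only [inducedSingle_apply, Finset.sum_mul_sum, map_mul]
          rw [Finset.sum_comm]
          refine Finset.sum_congr rfl fun h _ => ?_
          rw [Finset.sum_comm]
          refine Finset.sum_congr rfl fun h' _ => ?_
          split_ifs <;> simp_all [Finset.mul_sum, mul_assoc]
      _ = ∑ h, if x = i h * s ∧ y = i h * s then τ h c else 0 :=
          Finset.sum_congr rfl fun h _ => by
            rw [Finset.sum_eq_single_of_mem h (Finset.mem_univ h)]
            · simp [hab.sum_apply_mul_apply]
            · intro h' _ hh'
              simp [hab.sum_apply_mul_apply, hh'.symm]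
      _ = _ := by
          split_ifs with hxy
          · simp [hxy]
          · exact Finset.sum_eq_zero fun h _ => if_neg fun hs => hxy (hs.1.trans hs.2.symm)
  have sum_sum_single (x y : G) :
      ∑ j : G × ι, (inducedSingle i τ j.1 (c * a j.2) : G → C) x *
        (inducedSingle i τ j.1 (b j.2) : G → C) y = if x = y then 1 else 0 := by
    rw [Fintype.sum_prod_type]
    simp only [sum_single]
    split_ifs
    · rw [Finset.sum_comm, ← hc, galoisTrace_apply]
      simp [eq_comm (a := x), ← eq_inv_mul_iff_mul_eq]
    · simp
  constructor
  · ext x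
    simpa using sum_sum_single x x
  · intro g hg
    ext x
    simpa [inducedAction_apply, hg] using sum_sum_single x (x * g)

end Single

variable {i τ} in
theorem IsGaloisAction.induced [Finite G] [Finite H] [FaithfulSMul R C] (h : IsGaloisAction τ) :
    IsGaloisAction (inducedAction i τ) := by
  cases nonempty_fintype G
  cases nonempty_fintype H
  obtain ⟨m, a, b, hab⟩ := h.exists_coordinates
  obtain ⟨c, hc⟩ := h.exists_galoisTrace_eq_one
  refine (hab.induced hc).isGaloisAction fun f hf => ?_
  have hconst (x : G) : (f : G → C) x = (f : G → C) 1 := by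
    simpa [inducedAction_apply] using congr(($(hf x) : G → C) 1)
  obtain ⟨r, hr⟩ := h.exists_algebraMap_eq ((f : G → C) 1) fun h => by
    rw [← f.2 h 1, hconst]
  exact ⟨r, Subtype.ext <| funext fun x => hr.trans (hconst x).symm⟩

end Induced

end InvariantsAndInduction

section Descent

variable {G H : Type*} [Group G] [Group H] {F F' E M : Type u} [Field F] [Field F'] [Field E]
  [Algebra F F'] [Algebra E F'] [CommRing M] [Nontrivial M] [Algebra F' M] [Algebra F M]
  [IsScalarTower F F' M] [Algebra E M] [IsScalarTower E F' M]

namespace GTorsor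

theorem exists_algEquiv_of_equivariant [Finite G] {τ : G →* (M ≃ₐ[F'] M)} (hτ : IsGaloisAction τ)
    (t : GTorsor G F) (f : t.carrier →ₐ[F] M) (hf : ∀ g x, f (t.action g x) = τ g (f x)) :
    ∃ e : F' ⊗[F] t.carrier ≃ₐ[F'] M, ∀ g x, e (t.baseChangeAction F' g x) = τ g (e x) := by
  let f' : F' ⊗[F] t.carrier →ₐ[F'] M :=
    Algebra.TensorProduct.productLeftAlgHom (Algebra.ofId F' M) f
  have hf' (g : G) (x : F' ⊗[F] t.carrier) : f' (tensorAction F' t.action g x) = τ g (f' x) := by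
    induction x with
    | zero => simp
    | add x y hx hy => simp only [map_add, hx, hy]
    | tmul x y => simp [f', tensorAction_tmul, Algebra.ofId_apply, hf]
  exact ⟨.ofBijective f' ((t.isGaloisAction_baseChange F').bijective_of_equivariant hτ f' hf'), hf'⟩

theorem descendsTo_of_equivariant [Finite G] {τ : G →* (M ≃ₐ[F'] M)} (hτ : IsGaloisAction τ)
    (t : GTorsor G F) (f : t.carrier →ₐ[F] M) (hf : ∀ g x, f (t.action g x) = τ g (f x))
    (t' : GTorsor G E) (f' : t'.carrier →ₐ[E] M) (hf' : ∀ g x, f' (t'.action g x) = τ g (f' x)) :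
    t.DescendsTo F' E := by
  obtain ⟨e, he⟩ := t.exists_algEquiv_of_equivariant hτ f hf
  obtain ⟨e', he'⟩ := t'.exists_algEquiv_of_equivariant hτ f' hf'
  refine ⟨t', e.trans e'.symm, fun g x => e'.injective ?_⟩
  simp [he, he']

theorem DescendsTo.exists_equivariant {t : GTorsor G F} (h : t.DescendsTo F' E) :
    ∃ (t' : GTorsor G E) (f : t'.carrier →ₐ[E] F' ⊗[F] t.carrier),
      ∀ g x, f (t'.action g x) = tensorAction F' t.action g (f x) := by
  obtain ⟨t', e, he⟩ := h
  let e' : F' ⊗[E] t'.carrier →ₐ[E] F' ⊗[F] t.carrier := (e.symm.restrictScalars E).toAlgHom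
  refine ⟨t', e'.comp Algebra.TensorProduct.includeRight, fun g x => e.injective ?_⟩
  calc e (e.symm (1 ⊗ₜ t'.action g x)) = t'.baseChangeAction F' g (e (e.symm (1 ⊗ₜ x))) := by
        simp [baseChangeAction]
    _ = e (t.baseChangeAction F' g (e.symm (1 ⊗ₜ x))) := (he g _).symm

end GTorsor

section Induced

variable {G : Type u} [Group G] [Finite G] [Finite H] (i : H →* G)

namespace GTorsor

/-- The `G`-torsor induced from an `H`-torsor along `i : H →* G`. -/
def induced (t : GTorsor H F) : GTorsor G F :=
  (t.isGaloisAction.induced (i := i)).toGTorsor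

/-- The canonical homomorphism from an induced torsor to the original one. -/
def inducedEval (t : GTorsor H F) : (t.induced i).carrier →ₐ[F] t.carrier :=
  _root_.inducedEval i t.action

theorem inducedEval_action (t : GTorsor H F) (h : H) (x : (t.induced i).carrier) :
    t.inducedEval i ((t.induced i).action (i h) x) = t.action h (t.inducedEval i x) :=
  inducedEval_inducedAction i t.action h x

variable {i}

theorem descendsTo_of_equivariant_induced {τ : H →* (M ≃ₐ[F'] M)} (hτ : IsGaloisAction τ)
    (t : GTorsor G F) (f : t.carrier →ₐ[F] M) (hf : ∀ h x, f (t.action (i h) x) = τ h (f x))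
    (t' : GTorsor H E) (f' : t'.carrier →ₐ[E] M) (hf' : ∀ h x, f' (t'.action h x) = τ h (f' x)) :
    t.DescendsTo F' E := by
  have hf'' (h : H) (x : (t'.induced i).carrier) :
      f'.comp (t'.inducedEval i) ((t'.induced i).action (i h) x) =
        τ h (f'.comp (t'.inducedEval i) x) := by
    simp [inducedEval_action, hf']
  exact descendsTo_of_equivariant (hτ.induced (i := i)) t (inducedLift f hf)
    (inducedLift_apply_apply f hf) (t'.induced i) (inducedLift _ hf'')
    (inducedLift_apply_apply _ hf'')

end GTorsor

end Induced

theorem IsGaloisAction.exists_descent_of_equivariant [Finite H] {τ : H →* (M ≃ₐ[F'] M)}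
    (hτ : IsGaloisAction τ) {N : Type*} [CommRing N] [Algebra E N] [Algebra.IsIntegral E N]
    {ρ : H →* (N ≃ₐ[E] N)} {ι : Type*} [Fintype ι] {a b : ι → N} (hab : IsGaloisCoordinates ρ a b)
    (φ : N →ₐ[E] M) (hφ : ∀ h x, φ (ρ h x) = τ h (φ x)) :
    ∃ E' : IntermediateField E F', Algebra.IsAlgebraic E E' ∧
      ∃ (t : GTorsor H E') (f : t.carrier →ₐ[E'] M), ∀ h x, f (t.action h x) = τ h (f x) := by
  -- `M` descends to the subalgebra `φ N`, whose ring of invariants is `E' = F' ∩ φ N`.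
  let S : Subalgebra E F' := φ.range.comap ((Algebra.ofId F' M).restrictScalars E)
  have hS : S.IsAlgebraic := by
    rintro x ⟨y, hy⟩
    refine IsIntegral.isAlgebraic ((isIntegral_algHom_iff
      ((Algebra.ofId F' M).restrictScalars E) (algebraMap F' M).injective).1 ?_)
    exact hy ▸ (Algebra.IsIntegral.isIntegral y).map φ
  let E' : IntermediateField E F' := hS.toIntermediateField
  let T : Subalgebra E' M :=
    { φ.range with algebraMap_mem' := fun c => c.2 }
  have hT (h : H) : ∀ x ∈ T, τ h x ∈ T := by
    rintro _ ⟨y, rfl⟩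
    exact ⟨ρ h y, hφ h y⟩
  have hTab : IsGaloisCoordinates (restrictAction τ T hT)
      (fun j => φ.rangeRestrict (a j)) fun j => φ.rangeRestrict (b j) :=
    hab.map (i := .id H) Function.injective_id (φ.rangeRestrict : N →+* T)
      fun h x => Subtype.ext (hφ h x)
  have hTτ : IsGaloisAction (restrictAction τ T hT) := hTab.isGaloisAction fun x hx => by
    obtain ⟨c, hc⟩ := hτ.exists_algebraMap_eq x fun h => congrArg Subtype.val (hx h)
    have hcE' : c ∈ E' := show algebraMap F' M c ∈ φ.range from hc ▸ x.2
    exact ⟨⟨c, hcE'⟩, Subtype.ext hc⟩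
  exact ⟨E', (Subalgebra.isAlgebraic_iff S).1 hS, hTτ.toGTorsor, T.val, fun h x => rfl⟩

end Descent

section EssentialDim

variable {k : Type u} [Field k] {l : ℕ}

theorem GTorsor.essentialDim_le {G : Type v} [Group G] {F : Type u} [Field F] [Algebra k F]
    (t : GTorsor G F) (F' : Type u) [i₁ : Field F'] [i₂ : Algebra k F'] [i₃ : Algebra F F']
    [i₄ : IsScalarTower k F F'] [i₅ : FiniteDimensional F F'] (hl : ¬ l ∣ Module.finrank F F')
    (E : IntermediateField k F') (h : t.DescendsTo F' E) :
    t.essentialDim k l ≤ Cardinal.toENat (Algebra.trdeg k E) := by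
  unfold GTorsor.essentialDim
  refine (iInf_le _ F').trans ((iInf_le _ i₁).trans ((iInf_le _ i₂).trans ?_))
  refine (iInf_le _ i₃).trans ?_
  exact (iInf_le _ i₄).trans ((iInf_le _ i₅).trans ((iInf_le _ hl).trans
    ((iInf_le _ E).trans (iInf_le _ h))))

theorem GTorsor.le_essentialDim {G : Type v} [Group G] {F : Type u} [Field F] [Algebra k F]
    (t : GTorsor G F) {d : ℕ∞}
    (h : ∀ (F' : Type u) [Field F'] [Algebra k F'] [Algebra F F'] [IsScalarTower k F F']
      [FiniteDimensional F F'] (_ : ¬ l ∣ Module.finrank F F') (E : IntermediateField k F')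
      (_ : t.DescendsTo F' E), d ≤ Cardinal.toENat (Algebra.trdeg k E)) :
    d ≤ t.essentialDim k l :=
  le_iInf fun F' => le_iInf fun _ => le_iInf fun _ => le_iInf fun _ => le_iInf fun _ =>
    le_iInf fun _ => le_iInf fun hl => le_iInf fun E => le_iInf fun h' => h F' hl E h'

theorem GTorsor.essentialDim_le_essentialDim {G : Type v} [Group G] {F : Type u} [i₁ : Field F]
    [i₂ : Algebra k F] (t : GTorsor G F) : t.essentialDim k l ≤ _root_.essentialDim k G l := by
  unfold _root_.essentialDim
  refine le_trans ?_ (le_iSup _ F)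
  refine le_trans ?_ (le_iSup _ i₁)
  refine le_trans ?_ (le_iSup _ i₂)
  exact le_iSup (fun t : GTorsor G F => t.essentialDim k l) t

theorem essentialDim_le {G : Type v} [Group G] {d : ℕ∞}
    (h : ∀ (F : Type u) [Field F] [Algebra k F] (t : GTorsor G F), t.essentialDim k l ≤ d) :
    essentialDim k G l ≤ d :=
  iSup_le fun F => iSup_le fun _ => iSup_le fun _ => iSup_le fun t => h F t

theorem trdeg_restrictScalars_of_isAlgebraic {F : Type*} [Field F] [Algebra k F]
    (E : IntermediateField k F) (E' : IntermediateField E F) [Algebra.IsAlgebraic E E'] :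
    Algebra.trdeg k (E'.restrictScalars k) = Algebra.trdeg k E := by
  change Algebra.trdeg k E' = _
  have : FaithfulSMul E E' :=
    (faithfulSMul_iff_algebraMap_injective E E').2 (algebraMap E E').injective
  rw [← trdeg_add_eq k E (A := E'), trdeg_eq_zero (R := E), add_zero]

theorem essentialDim_le_of_injective {H : Type v} [Group H] {G : Type u} [Group G] [Finite G]
    {i : H →* G} (hi : Function.Injective i) : essentialDim k H l ≤ essentialDim k G l := by
  have : Finite H := .of_injective i hi
  refine essentialDim_le fun F _ _ t => le_trans ?_ (t.induced i).essentialDim_le_essentialDim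
  refine (t.induced i).le_essentialDim fun F' _ _ _ _ _ hl E hE => ?_
  obtain ⟨N, φ, hφ⟩ := hE.exists_equivariant
  let q : F' ⊗[F] (t.induced i).carrier →ₐ[F'] F' ⊗[F] t.carrier :=
    Algebra.TensorProduct.map (.id F' F') (t.inducedEval i)
  have hq (h : H) (x : F' ⊗[F] (t.induced i).carrier) :
      q (tensorAction F' (t.induced i).action (i h) x) = tensorAction F' t.action h (q x) := by
    induction x with
    | zero => simp
    | add x y hx hy => simp only [map_add, hx, hy]
    | tmul x y => simp [q, tensorAction_tmul, GTorsor.inducedEval_action]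
  obtain ⟨m, a, b, hab⟩ := N.isGaloisAction.exists_coordinates
  have := N.isGaloisAction.finite
  obtain ⟨E', _, t', f, hf⟩ := (t.isGaloisAction_baseChange F').exists_descent_of_equivariant
    (hab.map hi (.id N.carrier) (τ := N.action.comp i) fun _ _ => rfl)
    ((q.restrictScalars E).comp φ) fun h x => (congrArg q (hφ (i h) x)).trans (hq h _)
  have htE' : t.DescendsTo F' E' :=
    GTorsor.descendsTo_of_equivariant (t.isGaloisAction_baseChange F') t
      Algebra.TensorProduct.includeRight (fun _ _ => rfl) t' f hf
  exact (t.essentialDim_le F' hl (E'.restrictScalars k) htE').trans_eq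
    congr(Cardinal.toENat $(trdeg_restrictScalars_of_isAlgebraic E E'))

end EssentialDim

section CoprimeIndex

theorem finrank_eq_sum_maximalSpectrum {F A P : Type*} [Field F] [CommRing A] [IsReduced A]
    [Algebra F A] [Module.Finite F A] [IsArtinianRing A] [Fintype (MaximalSpectrum A)]
    [AddCommGroup P] [Module A P] [Module F P] [IsScalarTower F A P] [Module.Finite F P] :
    Module.finrank F P =
      ∑ I : MaximalSpectrum A, Module.finrank F ((A ⧸ I.asIdeal) ⊗[A] P) := by
  classical
  have : Module.Finite A P := .of_restrictScalars_finite F A P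
  have (I : MaximalSpectrum A) : Module.Finite F ((A ⧸ I.asIdeal) ⊗[A] P) := .trans A _
  let e : P ≃ₗ[A] ∀ I : MaximalSpectrum A, (A ⧸ I.asIdeal) ⊗[A] P :=
    (TensorProduct.lid A P).symm ≪≫ₗ
      (IsArtinianRing.equivPi A).toLinearEquiv.rTensor P ≪≫ₗ TensorProduct.piLeft ..
  rw [(e.restrictScalars F).finrank_eq, Module.finrank_pi_fintype]

variable {H : Type v} [Group H] [Finite H] {l : ℕ}

theorem IsGaloisAction.exists_not_dvd_finrank_quotient {F A L : Type u} [Field F] [CommRing A]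
    [CommRing L] [Algebra F A] [Algebra F L] [Algebra A L] [IsScalarTower F A L] [IsReduced A]
    [FaithfulSMul A L] [Module.Finite F A] {τ : H →* (L ≃ₐ[A] L)} (hτ : IsGaloisAction τ)
    (hl : ¬ l * Nat.card H ∣ Module.finrank F L) :
    ∃ I : MaximalSpectrum A, Nontrivial ((A ⧸ I.asIdeal) ⊗[A] L) ∧
      ¬ l ∣ Module.finrank F (A ⧸ I.asIdeal) := by
  have := IsArtinianRing.of_finite F A
  have := hτ.finite
  have : Module.Finite F L := .trans A L
  cases nonempty_fintype (MaximalSpectrum A)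
  by_contra! h
  rw [finrank_eq_sum_maximalSpectrum (A := A)] at hl
  refine hl (Finset.dvd_sum fun I _ => ?_)
  rcases subsingleton_or_nontrivial ((A ⧸ I.asIdeal) ⊗[A] L) with hI | hI
  · simp [Module.finrank_zero_of_subsingleton]
  · let := Ideal.Quotient.field I.asIdeal
    have hcard : Module.finrank (A ⧸ I.asIdeal) ((A ⧸ I.asIdeal) ⊗[A] L) = Nat.card H :=
      (hτ.baseChange (A ⧸ I.asIdeal)).toGTorsor.finrank_eq_card
    rw [← Module.finrank_mul_finrank F (A ⧸ I.asIdeal), hcard]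
    exact mul_dvd_mul_right (h I hI) _

theorem GTorsor.exists_reduction {G : Type*} [Group G] [Finite G] {i : H →* G} {F : Type u}
    [Field F] (hi : Function.Injective i) (hl : ¬ l ∣ i.range.index) (t : GTorsor G F) :
    ∃ (F₁ : Type u) (_ : Field F₁) (_ : Algebra F F₁), FiniteDimensional F F₁ ∧
      ¬ l ∣ Module.finrank F F₁ ∧ ∃ (s : GTorsor H F₁) (φ : t.carrier →+* s.carrier),
        (∀ c, φ (algebraMap F t.carrier c) = algebraMap F₁ s.carrier (algebraMap F F₁ c)) ∧
          ∀ h x, φ (t.action (i h) x) = s.action h (φ x) := by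
  let ρ : H →* (t.carrier ≃ₐ[F] t.carrier) := t.action.comp i
  obtain ⟨m, a, b, hab⟩ := t.isGaloisAction.exists_coordinates
  have hρ : IsGaloisAction (invariantsAction ρ) :=
    (hab.map hi (.id t.carrier) (τ := ρ) fun _ _ => rfl).isGaloisAction_invariantsAction
  have := t.isGaloisAction.finite
  have := t.isGaloisAction.isReduced
  have : IsReduced (invariants ρ) := isReduced_of_injective (invariants ρ).val Subtype.val_injective
  have hdvd : ¬ l * Nat.card H ∣ Module.finrank F t.carrier := fun h => hl <| by
    rw [t.finrank_eq_card, ← i.range.index_mul_card,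
      ← Nat.card_congr (MonoidHom.ofInjective hi).toEquiv] at h
    exact Nat.dvd_of_mul_dvd_mul_right Nat.card_pos h
  obtain ⟨I, _, hI⟩ := hρ.exists_not_dvd_finrank_quotient hdvd
  let := Ideal.Quotient.field I.asIdeal
  refine ⟨invariants ρ ⧸ I.asIdeal, inferInstance, inferInstance, inferInstance, hI,
    (hρ.baseChange _).toGTorsor, Algebra.TensorProduct.includeRight.toRingHom, fun c => ?_,
    fun h x => rfl⟩
  exact Algebra.TensorProduct.includeRight.commutes (algebraMap F (invariants ρ) c)

variable {k : Type u} [Field k]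

theorem essentialDim_le_of_not_dvd_index {G : Type u} [Group G] [Finite G] {i : H →* G}
    (hi : Function.Injective i) (hp : l.Prime) (hl : ¬ l ∣ i.range.index) :
    essentialDim k G l ≤ essentialDim k H l := by
  refine essentialDim_le fun F _ _ t => ?_
  obtain ⟨F₁, _, _, _, hF₁, s, φ, hφ, hφ'⟩ := t.exists_reduction hi hl
  let : Algebra k F₁ := ((algebraMap F F₁).comp (algebraMap k F)).toAlgebra
  have : IsScalarTower k F F₁ := .of_algebraMap_eq fun _ => rfl
  refine le_trans ?_ s.essentialDim_le_essentialDim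
  refine s.le_essentialDim fun F' _ _ _ _ _ hF' E hE => ?_
  let : Algebra F F' := ((algebraMap F₁ F').comp (algebraMap F F₁)).toAlgebra
  have : IsScalarTower F F₁ F' := .of_algebraMap_eq fun _ => rfl
  have : IsScalarTower k F F' := .of_algebraMap_eq fun c => by
    rw [IsScalarTower.algebraMap_apply k F₁ F', IsScalarTower.algebraMap_apply k F F₁]
    rfl
  have : FiniteDimensional F F' := .trans F F₁ F'
  have hFF' : ¬ l ∣ Module.finrank F F' := by
    rw [← Module.finrank_mul_finrank F F₁ F', hp.dvd_mul]
    exact not_or.2 ⟨hF₁, hF'⟩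
  obtain ⟨s', f', hf'⟩ := hE.exists_equivariant
  let f : t.carrier →ₐ[F] F' ⊗[F₁] s.carrier :=
    { (Algebra.TensorProduct.includeRight : s.carrier →ₐ[F₁] F' ⊗[F₁] s.carrier).toRingHom.comp
        φ with
      commutes' := fun c => by
        change Algebra.TensorProduct.includeRight (φ (algebraMap F t.carrier c)) = _
        rw [hφ, AlgHom.commutes, ← IsScalarTower.algebraMap_apply] }
  have hf (h : H) (x : t.carrier) :
      f (t.action (i h) x) = tensorAction F' s.action h (f x) := by
    change (1 : F') ⊗ₜ[F₁] φ (t.action (i h) x) = 1 ⊗ₜ s.action h (φ x)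
    rw [hφ']
  exact t.essentialDim_le F' hFF' E <|
    t.descendsTo_of_equivariant_induced (s.isGaloisAction_baseChange F') f hf s' f' hf'

theorem essentialDim_eq_of_not_dvd_index {H G : Type*} [Group H] [Group G] [Finite G]
    {i : H →* G} (hi : Function.Injective i) (hp : l.Prime) (hl : ¬ l ∣ i.range.index) :
    essentialDim k H l = essentialDim k G l := by
  have : Finite H := .of_injective i hi
  have : Small.{u} G := Countable.toSmall G
  let e : G ≃* Shrink.{u} G := Shrink.mulEquiv.symm
  let e' : G →* Shrink.{u} G := e
  have : Finite (Shrink.{u} G) := .of_equiv _ e.toEquiv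
  have he' : Function.Injective e' := e.injective
  have index_range_e' : e'.range.index = 1 := by
    rw [MonoidHom.range_eq_top.2 e.surjective, Subgroup.index_top]
  have index_range_comp : (e'.comp i).range.index = i.range.index := by
    rw [MonoidHom.range_comp]
    exact Subgroup.index_map_of_bijective e.bijective _
  have hinj : Function.Injective (e'.comp i) := he'.comp hi
  calc essentialDim k H l = essentialDim k (Shrink.{u} G) l :=
        (essentialDim_le_of_injective hinj).antisymm
          (essentialDim_le_of_not_dvd_index hinj hp (index_range_comp ▸ hl))
    _ = essentialDim k G l :=
        (essentialDim_le_of_not_dvd_index he' hp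
          (by simpa [index_range_e'] using hp.ne_one)).antisymm (essentialDim_le_of_injective he')

end CoprimeIndex

section HermitianForm

variable {K V : Type*} [Field K] [AddCommGroup V] [Module K V] {σ : K →+* K}
  {B : V →ₛₗ[σ] V →ₗ[K] K}

theorem exists_apply_self_ne_zero (hσ : σ ≠ .id K) (hB : B.IsSymm) (hB0 : B ≠ 0) :
    ∃ v, B v v ≠ 0 := by
  by_contra! hiso
  obtain ⟨x, y, hxy⟩ : ∃ x y, B x y ≠ 0 := by
    by_contra! h
    exact hB0 (LinearMap.ext₂ h)
  have add_map_eq_zero (d : K) : d + σ d = 0 := by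
    have h := hiso (x + (d / B x y) • y)
    simpa [hiso, ← hB.eq x y, hxy] using h
  refine hσ (RingHom.ext fun d => ?_)
  have h1 : (1 : K) = -1 := eq_neg_of_add_eq_zero_left (by simpa using add_map_eq_zero 1)
  rw [RingHom.id_apply, eq_neg_of_add_eq_zero_right (add_map_eq_zero d), neg_eq_neg_one_mul, ← h1,
    one_mul]

theorem exists_apply_self_eq_one (hσ : σ ≠ .id K) (hnorm : ∀ a, σ a = a → ∃ c, c * σ c = a)
    (hB : B.IsSymm) (hB0 : B ≠ 0) : ∃ v, B v v = 1 := by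
  obtain ⟨v, hv⟩ := exists_apply_self_ne_zero hσ hB hB0
  obtain ⟨c, hc⟩ := hnorm (B v v)⁻¹ (by rw [map_inv₀, hB.eq])
  refine ⟨c • v, ?_⟩
  rw [LinearMap.map_smulₛₗ₂, map_smul, smul_eq_mul, smul_eq_mul, ← mul_assoc, mul_comm (σ c), hc,
    inv_mul_cancel₀ hv]

theorem separatingLeft_domRestrict_ker (hB : B.IsSymm) (hsep : B.SeparatingLeft) {v : V}
    (hv : B v v = 1) : (B.domRestrict₁₂ (B v).ker (B v).ker).SeparatingLeft := by
  refine fun w hw => Subtype.ext (hsep w fun x => ?_)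
  have hwv : B w v = 0 := by rw [← hB.eq, LinearMap.mem_ker.1 w.2, map_zero]
  have hx : x - B v x • v ∈ (B v).ker := by simp [hv]
  have h : B w (x - B v x • v) = 0 := hw ⟨_, hx⟩
  simpa [hwv] using h

theorem exists_orthonormal (hσ : σ ≠ .id K) (hnorm : ∀ a, σ a = a → ∃ c, c * σ c = a)
    [FiniteDimensional K V] (hB : B.IsSymm) (hsep : B.SeparatingLeft) {n : ℕ}
    (hn : Module.finrank K V = n) :
    ∃ v : Fin n → V, ∀ i j, B (v i) (v j) = if i = j then 1 else 0 := by
  induction n generalizing V with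
  | zero => exact ⟨Fin.elim0, fun i => i.elim0⟩
  | succ n ih =>
    have : Nontrivial V := Module.nontrivial_of_finrank_pos (R := K) (by omega)
    have hB0 : B ≠ 0 := by
      rintro rfl
      exact LinearMap.not_separatingLeft_zero V V σ (.id K) hsep
    obtain ⟨v, hv⟩ := exists_apply_self_eq_one hσ hnorm hB hB0
    have hBv : B v ≠ 0 := fun h => by simp [h] at hv
    have hker : Module.finrank K (B v).ker = n := by
      have := Module.Dual.finrank_ker_add_one_of_ne_zero hBv
      omega
    obtain ⟨w, hw⟩ := ih (hB.domRestrict _) (separatingLeft_domRestrict_ker hB hsep hv) hker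
    have hvw (i : Fin n) : B v (w i) = 0 := LinearMap.mem_ker.1 (w i).2
    have hwv (i : Fin n) : B (w i) v = 0 := by rw [← hB.eq, hvw, map_zero]
    refine ⟨Fin.cons v fun i => w i, fun i j => ?_⟩
    cases i using Fin.cases <;> cases j using Fin.cases
    · simpa using hv
    · simp [hvw, (Fin.succ_ne_zero _).symm]
    · simp [hwv, Fin.succ_ne_zero]
    · simpa using show B (w _) (w _) = _ from hw _ _

end HermitianForm

section HermitianMatrix

variable {K n : Type*} [Field K] [Fintype n] {σ : K →+* K} {β : Matrix n n K}

/-- The sesquilinear form `(x, y) ↦ yᵀ β (σ x)` of a matrix `β`; it is semilinear in the first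
variable, as usual for sesquilinear forms in Mathlib. -/
def sesqForm (σ : K →+* K) (β : Matrix n n K) : (n → K) →ₛₗ[σ] (n → K) →ₗ[K] K :=
  LinearMap.mk₂'ₛₗ σ (.id K) (fun x y => y ⬝ᵥ (β *ᵥ (σ ∘ x)))
    (fun x x' y => by
      rw [← dotProduct_add, ← Matrix.mulVec_add]
      congr 2
      ext i
      simp)
    (fun c x y => by
      rw [smul_eq_mul, ← smul_eq_mul, ← dotProduct_smul, ← Matrix.mulVec_smul]
      congr 2
      ext i
      simp)
    (fun x y y' => by simp) (fun c x y => by simp)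

theorem isSymm_sesqForm (hσ : Function.Involutive σ) (hβ : βᵀ = β.map σ) :
    (sesqForm σ β).IsSymm where
  eq x y := by
    have hσσ : σ ∘ σ ∘ x = x := by ext; simp [hσ _]
    calc σ (y ⬝ᵥ (β *ᵥ (σ ∘ x))) = (σ ∘ y) ⬝ᵥ (β.map σ *ᵥ (σ ∘ σ ∘ x)) := by
          rw [RingHom.map_dotProduct]
          congr 1
          ext i
          simp [RingHom.map_mulVec]
      _ = x ⬝ᵥ (β *ᵥ (σ ∘ y)) := by
          rw [hσσ, ← hβ, Matrix.mulVec_transpose, dotProduct_comm, ← Matrix.dotProduct_mulVec]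

variable [DecidableEq n]

theorem separatingLeft_sesqForm (hβ : IsUnit β.det) : (sesqForm σ β).SeparatingLeft := by
  intro x hx
  have hβx : β *ᵥ (σ ∘ x) = 0 := dotProduct_eq_zero _ fun y => by
    rw [dotProduct_comm]
    exact hx y
  have hσx := Matrix.eq_zero_of_mulVec_eq_zero hβ.ne_zero hβx
  exact funext fun i => by simpa using congrFun hσx i

end HermitianMatrix

theorem exists_transpose_mul_map_eq {K : Type*} [Field K] {σ : K →+* K}
    (hinv : Function.Involutive σ) (hσ : σ ≠ .id K) (hnorm : ∀ a, σ a = a → ∃ c, c * σ c = a)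
    {n : ℕ} {β : Matrix (Fin n) (Fin n) K} (hβ : IsUnit β.det) (hherm : βᵀ = β.map σ) :
    ∃ P : GL (Fin n) K, P.1ᵀ * P.1.map σ = β := by
  obtain ⟨v, hv⟩ := exists_orthonormal hσ hnorm (isSymm_sesqForm hinv hherm)
    (separatingLeft_sesqForm hβ) (Module.finrank_fin_fun K)
  let V : Matrix (Fin n) (Fin n) K := (Matrix.of v)ᵀ
  have hV : Vᵀ * β * V.map σ = 1 := by
    ext i j
    rw [Matrix.one_apply, Matrix.mul_assoc]
    exact (hv j i).trans (if_congr eq_comm rfl rfl)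
  have hdet : IsUnit V.det := by
    have := congrArg Matrix.det hV
    rw [Matrix.det_mul, Matrix.det_mul, Matrix.det_transpose, Matrix.det_one, mul_assoc] at this
    exact .of_mul_eq_one _ this
  let W := Matrix.GeneralLinearGroup.mk'' V hdet
  have hVW : V * W⁻¹.1 = 1 := W.mul_inv
  refine ⟨W⁻¹, ?_⟩
  calc W⁻¹.1ᵀ * W⁻¹.1.map σ = W⁻¹.1ᵀ * (Vᵀ * β * V.map σ) * W⁻¹.1.map σ := by
        rw [hV, Matrix.mul_one]
    _ = (V * W⁻¹.1)ᵀ * β * (V * W⁻¹.1).map σ := by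
        simp only [Matrix.transpose_mul, Matrix.map_mul, Matrix.mul_assoc]
    _ = β := by rw [hVW]; simp

section FiniteField

theorem ker_powMonoidHom_eq_range_powMonoidHom {G : Type*} [CommGroup G] [IsCyclic G] [Finite G]
    {m n : ℕ} (h : Nat.card G = m * n) :
    (powMonoidHom m : G →* G).ker = (powMonoidHom n).range := by
  have hn : n ≠ 0 := by
    rintro rfl
    exact Nat.card_pos.ne' h
  refine (Subgroup.eq_of_le_of_card_ge ?_ (le_of_eq ?_)).symm
  · rintro _ ⟨x, rfl⟩
    rw [MonoidHom.mem_ker, powMonoidHom_apply, powMonoidHom_apply, ← pow_mul, mul_comm, ← h,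
      pow_card_eq_one']
  · rw [IsCyclic.card_powMonoidHom_ker, IsCyclic.card_powMonoidHom_range, h, Nat.gcd_mul_right_left,
      Nat.gcd_mul_left_left, Nat.mul_div_cancel _ (Nat.pos_of_ne_zero hn)]

variable {K : Type*} [Field K] {p r q : ℕ}

theorem one_lt_of_card_eq_sq [Finite K] (hK : Nat.card K = q ^ 2) : 1 < q := by
  have h : 1 < Nat.card K := Finite.one_lt_card
  rw [hK] at h
  exact (one_lt_pow_iff two_ne_zero).1 h

theorem card_units_of_card_eq_sq (hK : Nat.card K = q ^ 2) :
    Nat.card Kˣ = (q - 1) * (q + 1) := by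
  rw [Nat.card_units, hK, mul_comm, ← Nat.sq_sub_sq, one_pow]

theorem card_ker_powMonoidHom_units [Finite K] (hK : Nat.card K = q ^ 2) :
    Nat.card (powMonoidHom (q + 1) : Kˣ →* Kˣ).ker = q + 1 := by
  rw [IsCyclic.card_powMonoidHom_ker, card_units_of_card_eq_sq hK, Nat.gcd_mul_left_left]

variable [Finite K] [Fact p.Prime] [CharP K p]

theorem iterateFrobenius_involutive (hK : Nat.card K = (p ^ r) ^ 2) :
    Function.Involutive (iterateFrobenius K p r) := fun x => by
  have := Fintype.ofFinite K
  rw [iterateFrobenius_def, iterateFrobenius_def, ← pow_mul, ← sq, ← hK, Nat.card_eq_fintype_card,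
    FiniteField.pow_card]

theorem iterateFrobenius_ne_id (hK : Nat.card K = (p ^ r) ^ 2) :
    iterateFrobenius K p r ≠ .id K := by
  intro h
  have hq := one_lt_of_card_eq_sq hK
  have hexp (x : Kˣ) : x ^ (p ^ r - 1) = 1 := by
    rw [← mul_left_inj x, ← pow_succ, Nat.sub_add_cancel hq.le, one_mul]
    exact Units.ext (by simpa [iterateFrobenius_def] using congr($h x))
  have hdvd : (p ^ r - 1) * (p ^ r + 1) ∣ p ^ r - 1 := by
    rw [← card_units_of_card_eq_sq hK, ← IsCyclic.exponent_eq_card]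
    exact Monoid.exponent_dvd_of_forall_pow_eq_one hexp
  have hle := Nat.le_of_dvd (by omega) hdvd
  nlinarith [Nat.sub_add_cancel hq.le]

theorem exists_mul_iterateFrobenius_eq (hK : Nat.card K = (p ^ r) ^ 2) {a : K}
    (ha : iterateFrobenius K p r a = a) : ∃ c, c * iterateFrobenius K p r c = a := by
  obtain rfl | ha0 := eq_or_ne a 0
  · exact ⟨0, by simp⟩
  have hq := one_lt_of_card_eq_sq hK
  lift a to Kˣ using ha0.isUnit
  have hker : a ∈ (powMonoidHom (p ^ r - 1) : Kˣ →* Kˣ).ker := by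
    rw [MonoidHom.mem_ker, powMonoidHom_apply, ← mul_left_inj a, ← pow_succ,
      Nat.sub_add_cancel hq.le, one_mul]
    exact Units.ext (by simpa [iterateFrobenius_def] using ha)
  rw [ker_powMonoidHom_eq_range_powMonoidHom (card_units_of_card_eq_sq hK)] at hker
  obtain ⟨c, rfl⟩ := hker
  exact ⟨c, by simp [iterateFrobenius_def, pow_succ']⟩

end FiniteField

section MonomialMatrices

variable {R ι : Type*} [CommRing R] [Fintype ι] [DecidableEq ι] (μ : Subgroup Rˣ)

/-- The representation of the wreath product of `μ` and the symmetric group by monomial matrices: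
the permutation `π` with coefficients `a` has the entry `a (π j)` at `(π j, j)`. -/
def monomialHom : ((ι → μ) ⋊[mulAutArrow] Equiv.Perm ι) →* Matrix ι ι R where
  toFun x := .of fun i j => if i = x.right j then ((x.left i : Rˣ) : R) else 0
  map_one' := by
    ext i j
    obtain rfl | h := eq_or_ne i j <;> simp [*]
  map_mul' x y := by
    ext i j
    rw [Matrix.mul_apply, Finset.sum_eq_single (y.right j)]
    · have hleft : (x * y).left (x.right (y.right j)) =
          x.left (x.right (y.right j)) * y.left (y.right j) :=
        congr(x.left _ * y.left $(x.right.symm_apply_apply _))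
      obtain rfl | h := eq_or_ne i (x.right (y.right j))
      · simpa using congr((($hleft : Rˣ) : R))
      · simp [h]
    · intro k _ hk
      simp [hk]
    · simp

theorem monomialHom_apply (x : (ι → μ) ⋊[mulAutArrow] Equiv.Perm ι) (i j : ι) :
    monomialHom μ x i j = if i = x.right j then ((x.left i : Rˣ) : R) else 0 :=
  rfl

theorem monomialHom_injective [Nontrivial R] : Function.Injective (monomialHom (ι := ι) μ) := by
  rw [injective_iff_map_eq_one]
  intro x hx
  have hentry (i j : ι) : (if i = x.right j then ((x.left i : Rˣ) : R) else 0) =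
      (1 : Matrix ι ι R) i j := by
    rw [← monomialHom_apply, hx]
  have hright : x.right = 1 := by
    ext1 j
    by_contra hj
    have h := hentry (x.right j) j
    rw [if_pos rfl, Matrix.one_apply_ne (show x.right j ≠ j from hj)] at h
    exact Units.ne_zero _ h
  refine SemidirectProduct.ext ?_ hright
  ext i
  simpa [hright] using hentry i i

theorem transpose_monomialHom_mul_map {σ : R →+* R} (hμ : ∀ a ∈ μ, (a : R) * σ a = 1)
    (x : (ι → μ) ⋊[mulAutArrow] Equiv.Perm ι) :
    (monomialHom μ x)ᵀ * (monomialHom μ x).map σ = 1 := by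
  ext i j
  rw [Matrix.mul_apply, Finset.sum_eq_single (x.right i)]
  · obtain rfl | h := eq_or_ne i j
    · simpa [monomialHom_apply] using hμ _ (x.left (x.right i)).2
    · simp [monomialHom_apply, h]
  · intro k _ hk
    simp [monomialHom_apply, hk]
  · simp

end MonomialMatrices

section MatUnitary

variable {R : Type*} [CommRing R] {n : ℕ} {σ : R →+* R}

theorem mem_matUnitary {β : Matrix (Fin n) (Fin n) R} {M : GL (Fin n) R} :
    M ∈ matUnitary σ β ↔ M.1ᵀ * β * M.1.map σ = β :=
  Iff.rfl

theorem conj_mem_matUnitary {M : GL (Fin n) R} (hM : M.1ᵀ * M.1.map σ = 1) (P : GL (Fin n) R) :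
    MulAut.conj P⁻¹ M ∈ matUnitary σ (P.1ᵀ * P.1.map σ) := by
  have hPM : P.1 * (MulAut.conj P⁻¹ M).1 = M.1 * P.1 := by
    rw [← Units.val_mul, ← Units.val_mul, MulAut.conj_apply, inv_inv, mul_assoc,
      mul_inv_cancel_left]
  rw [mem_matUnitary]
  calc _ = (P.1 * (MulAut.conj P⁻¹ M).1)ᵀ * (P.1 * (MulAut.conj P⁻¹ M).1).map σ := by
        simp only [Matrix.transpose_mul, Matrix.map_mul, Matrix.mul_assoc]
    _ = P.1ᵀ * (M.1ᵀ * M.1.map σ) * P.1.map σ := by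
        rw [hPM]
        simp only [Matrix.transpose_mul, Matrix.map_mul, Matrix.mul_assoc]
    _ = P.1ᵀ * P.1.map σ := by rw [hM, Matrix.mul_one]

theorem pow_mul_factorial_dvd_card_matUnitary [Nontrivial R] {μ : Subgroup Rˣ}
    (hμ : ∀ a ∈ μ, (a : R) * σ a = 1) (P : GL (Fin n) R) :
    Nat.card μ ^ n * n.factorial ∣ Nat.card (matUnitary σ (P.1ᵀ * P.1.map σ)) := by
  have hcard : Nat.card ((Fin n → μ) ⋊[mulAutArrow] Equiv.Perm (Fin n)) =
      Nat.card μ ^ n * n.factorial := by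
    rw [SemidirectProduct.card, Nat.card_perm, Nat.card_fun, Nat.card_fin]
  let f : ((Fin n → μ) ⋊[mulAutArrow] Equiv.Perm (Fin n)) →* GL (Fin n) R :=
    (MulAut.conj P⁻¹).toMonoidHom.comp (monomialHom μ).toHomUnits
  have hf : Function.Injective f := fun x y h =>
    monomialHom_injective μ (congrArg Units.val ((MulAut.conj P⁻¹).injective h))
  have hmem (x) : f x ∈ matUnitary σ (P.1ᵀ * P.1.map σ) :=
    conj_mem_matUnitary (transpose_monomialHom_mul_map μ hμ x) P
  rw [← hcard]
  exact Subgroup.card_dvd_of_injective (f.codRestrict _ hmem) (f.injective_codRestrict _ _ |>.2 hf)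

theorem det_mul_map_det_of_mem_matUnitary {β : Matrix (Fin n) (Fin n) R} (hβ : IsUnit β.det)
    {M : GL (Fin n) R} (hM : M ∈ matUnitary σ β) : M.1.det * σ M.1.det = 1 := by
  have hdet := congrArg Matrix.det (mem_matUnitary.1 hM)
  rw [Matrix.det_mul, Matrix.det_mul, Matrix.det_transpose, ← RingHom.mapMatrix_apply,
    ← RingHom.map_det] at hdet
  refine hβ.mul_left_cancel ?_
  rw [mul_one, ← mul_assoc, mul_comm β.det, hdet]

theorem matSpecialUnitary_le_matUnitary (σ : R →+* R) (β : Matrix (Fin n) (Fin n) R) :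
    matSpecialUnitary σ β ≤ matUnitary σ β :=
  inf_le_left

/-- The inclusion of the special unitary group in the special linear group. -/
def matSpecialUnitaryToSL (σ : R →+* R) (β : Matrix (Fin n) (Fin n) R) :
    matSpecialUnitary σ β →* Matrix.SpecialLinearGroup (Fin n) R where
  toFun M := ⟨M.1.1, congrArg Units.val M.2.2⟩
  map_one' := rfl
  map_mul' _ _ := rfl

variable (σ) (β : Matrix (Fin n) (Fin n) R)

theorem matSpecialUnitaryToSL_injective : Function.Injective (matSpecialUnitaryToSL σ β) :=
  fun _ _ h => Subtype.ext (Units.ext (congrArg Subtype.val h))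

theorem range_matSpecialUnitaryToSL :
    (matSpecialUnitaryToSL σ β).range = (matUnitary σ β).comap Matrix.SpecialLinearGroup.toGL := by
  ext M
  constructor
  · rintro ⟨M, rfl⟩
    exact M.2.1
  · exact fun hM => ⟨⟨Matrix.SpecialLinearGroup.toGL M, hM, Units.ext M.2⟩, rfl⟩

end MatUnitary

section Index

theorem relIndex_dvd_index_of_normal_right {G : Type*} [Group G] (H N : Subgroup G) [N.Normal]
    [N.FiniteIndex] : H.relIndex N ∣ H.index := by
  have hmul : H.relIndex N * N.index = N.relIndex H * H.index := by
    rw [← Subgroup.inf_relIndex_right, ← Subgroup.inf_relIndex_right N H,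
      Subgroup.relIndex_mul_index inf_le_right, Subgroup.relIndex_mul_index inf_le_right, inf_comm]
  obtain ⟨c, hc⟩ := Subgroup.relIndex_dvd_index_of_normal N H
  have hpos : N.relIndex H ≠ 0 :=
    ne_zero_of_dvd_ne_zero Subgroup.FiniteIndex.index_ne_zero ⟨c, hc⟩
  refine ⟨c, mul_left_cancel₀ hpos ?_⟩
  rw [← hmul, hc, mul_left_comm]

theorem index_range_matSpecialUnitaryToSL_dvd {R : Type*} [CommRing R] [Finite R] {n : ℕ}
    (σ : R →+* R) (β : Matrix (Fin n) (Fin n) R) :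
    (matSpecialUnitaryToSL σ β).range.index ∣ (matUnitary σ β).index := by
  have hrange : (Matrix.SpecialLinearGroup.toGL (n := Fin n) (R := R)).range =
      (Matrix.GeneralLinearGroup.det (n := Fin n) (R := R)).ker :=
    SetLike.coe_injective Matrix.SpecialLinearGroup.range_toGL
  rw [range_matSpecialUnitaryToSL, Subgroup.index_comap, hrange]
  exact relIndex_dvd_index_of_normal_right _ _

variable {l : ℕ}

theorem factorization_pow_sub_pow {Q i n : ℕ} (hl : l.Prime) (hl2 : l ≠ 2) (hQ : 1 < Q)
    (hlQ : l ∣ Q - 1) (hi : i < n) :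
    (Q ^ n - Q ^ i).factorization l = (Q - 1).factorization l + (n - i).factorization l := by
  have := Fact.mk hl
  have hlQ' : ¬ l ∣ Q := fun h => by
    have h1 : l ∣ Q - (Q - 1) := Nat.dvd_sub h hlQ
    rw [Nat.sub_sub_self hQ.le] at h1
    exact hl.one_lt.ne' (Nat.dvd_one.1 h1)
  have hsub : Q ^ (n - i) - 1 ≠ 0 := (Nat.sub_pos_of_lt (Nat.one_lt_pow (by omega) hQ)).ne'
  have hfactor : Q ^ n - Q ^ i = Q ^ i * (Q ^ (n - i) - 1) := by
    rw [Nat.mul_sub, ← pow_add, mul_one, Nat.add_sub_cancel' hi.le]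
  have hlte := padicValNat.pow_sub_pow (hl.odd_of_ne_two hl2) hQ hlQ hlQ' (n := n - i) (by omega)
  rw [one_pow] at hlte
  rw [hfactor, Nat.factorization_mul (by positivity) hsub, Finsupp.add_apply,
    Nat.factorization_eq_zero_of_not_dvd (mt hl.dvd_of_dvd_pow hlQ'), zero_add,
    Nat.factorization_def _ hl, hlte, Nat.factorization_def _ hl, Nat.factorization_def _ hl]

theorem factorization_prod_pow_sub_pow {Q : ℕ} (hl : l.Prime) (hl2 : l ≠ 2) (hQ : 1 < Q)
    (hlQ : l ∣ Q - 1) (n : ℕ) :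
    (∏ i : Fin n, (Q ^ n - Q ^ i.1)).factorization l =
      n * (Q - 1).factorization l + n.factorial.factorization l := by
  have hne (i : Fin n) : Q ^ n - Q ^ i.1 ≠ 0 :=
    (Nat.sub_pos_of_lt (Nat.pow_lt_pow_right hQ i.2)).ne'
  have hfactorial : n.factorial = ∏ i : Fin n, (n - i.1) := by
    rw [Fin.prod_univ_eq_prod_range (fun i => n - i), ← Finset.prod_range_add_one_eq_factorial,
      ← Finset.prod_range_reflect]
    exact Finset.prod_congr rfl fun i hi => by have := Finset.mem_range.1 hi; omega
  rw [hfactorial, Nat.factorization_prod fun i _ => hne i,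
    Nat.factorization_prod fun i _ => Nat.sub_ne_zero_of_lt i.2]
  simp [factorization_pow_sub_pow hl hl2 hQ hlQ, Finset.sum_add_distrib]

theorem not_dvd_of_mul_dvd_of_factorization_eq {c m N : ℕ} (hl : l.Prime) (hN : N ≠ 0)
    (h : c * m ∣ N) (hm : N.factorization l = m.factorization l) : ¬ l ∣ c := by
  intro hlc
  have hdvd := (mul_dvd_mul_right hlc m).trans h
  have hm0 : m ≠ 0 := right_ne_zero_of_mul (ne_zero_of_dvd_ne_zero hN h)
  have hle := (Nat.factorization_le_iff_dvd (mul_ne_zero hl.ne_zero hm0) hN).2 hdvd l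
  rw [Nat.factorization_mul hl.ne_zero hm0, Finsupp.add_apply, hl.factorization_self] at hle
  omega

theorem factorization_sq_sub_one {q : ℕ} (hl : l.Prime) (hl2 : l ≠ 2) (hq : 1 < q)
    (hlq : l ∣ q + 1) : (q ^ 2 - 1).factorization l = (q + 1).factorization l := by
  have hfactor : q ^ 2 - 1 = (q + 1) * (q - 1) := by simpa using Nat.sq_sub_sq q 1
  have hlq1 : ¬ l ∣ q - 1 := fun h => by
    have hl_dvd_two : l ∣ q + 1 - (q - 1) := Nat.dvd_sub hlq h
    rw [show q + 1 - (q - 1) = 2 by omega] at hl_dvd_two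
    exact hl2 ((Nat.prime_dvd_prime_iff_eq hl Nat.prime_two).1 hl_dvd_two)
  rw [hfactor, Nat.factorization_mul (by omega) (by omega), Finsupp.add_apply,
    Nat.factorization_eq_zero_of_not_dvd hlq1, add_zero]

variable {K : Type*} [Field K] [Finite K] {p r n : ℕ} [Fact p.Prime] [CharP K p]
  {β : Matrix (Fin n) (Fin n) K}

theorem relIndex_matSpecialUnitary_dvd (hβ : IsUnit β.det) :
    (matSpecialUnitary (iterateFrobenius K p r) β).relIndex
      (matUnitary (iterateFrobenius K p r) β) ∣ p ^ r + 1 := by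
  have hle : (matUnitary (iterateFrobenius K p r) β).map Matrix.GeneralLinearGroup.det ≤
      (powMonoidHom (p ^ r + 1) : Kˣ →* Kˣ).ker := by
    rintro _ ⟨M, hM, rfl⟩
    refine Units.ext ?_
    simpa [iterateFrobenius_def, pow_succ'] using det_mul_map_det_of_mem_matUnitary hβ hM
  rw [matSpecialUnitary, Subgroup.inf_relIndex_left, Subgroup.relIndex_ker]
  refine (Subgroup.card_dvd_of_le hle).trans ?_
  rw [IsCyclic.card_powMonoidHom_ker]
  exact Nat.gcd_dvd_right _ _

theorem not_dvd_index_matUnitary (hK : Nat.card K = (p ^ r) ^ 2) (hl : l.Prime) (hl2 : l ≠ 2)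
    (hlq : l ∣ p ^ r + 1) (hβ : IsUnit β.det) (hherm : βᵀ = β.map (iterateFrobenius K p r)) :
    ¬ l ∣ (matUnitary (iterateFrobenius K p r) β).index := by
  have := Fintype.ofFinite K
  have hq := one_lt_of_card_eq_sq hK
  have hlQ : l ∣ (p ^ r) ^ 2 - 1 := hlq.trans ⟨p ^ r - 1, by simpa using Nat.sq_sub_sq (p ^ r) 1⟩
  obtain ⟨P, rfl⟩ := exists_transpose_mul_map_eq (iterateFrobenius_involutive hK)
    (iterateFrobenius_ne_id hK) (fun _ => exists_mul_iterateFrobenius_eq hK) hβ hherm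
  have hcardGL : Nat.card (GL (Fin n) K) =
      ∏ i : Fin n, (((p ^ r) ^ 2) ^ n - ((p ^ r) ^ 2) ^ i.1) := by
    rw [Matrix.card_GL_field, ← Nat.card_eq_fintype_card, hK]
  have hdvd := pow_mul_factorial_dvd_card_matUnitary
    (μ := (powMonoidHom (p ^ r + 1) : Kˣ →* Kˣ).ker) (σ := iterateFrobenius K p r)
    (fun a ha => by simpa [iterateFrobenius_def, pow_succ'] using congrArg Units.val ha) P
  rw [card_ker_powMonoidHom_units hK] at hdvd
  refine not_dvd_of_mul_dvd_of_factorization_eq hl Nat.card_pos.ne'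
    ((mul_dvd_mul_left _ hdvd).trans (Subgroup.index_mul_card _).dvd) ?_
  rw [hcardGL, factorization_prod_pow_sub_pow hl hl2 (one_lt_pow₀ hq two_ne_zero) hlQ,
    factorization_sq_sub_one hl hl2 hq hlq, Nat.factorization_mul (by positivity)
    n.factorial_ne_zero, Nat.factorization_pow]
  rfl

end Index

theorem theorem10p1_general (p r l n : ℕ) [Fact p.Prime] (hl : l.Prime) (k : Type u) [Field k]
    (K : Type v) [Field K] [Finite K] [CharP K p] (hK : Nat.card K = (p ^ r) ^ 2)
    (β : Matrix (Fin n) (Fin n) K) (hβ : IsUnit β.det)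
    (hβherm : βᵀ = β.map (iterateFrobenius K p r)) :
    (¬ l ∣ p ^ r + 1 →
      essentialDim k (matSpecialUnitary (iterateFrobenius K p r) β) l =
        essentialDim k (matUnitary (iterateFrobenius K p r) β) l) ∧
    (l ≠ 2 → l ∣ p ^ r + 1 →
      essentialDim k (matSpecialUnitary (iterateFrobenius K p r) β) l =
        essentialDim k (Matrix.SpecialLinearGroup (Fin n) K) l) := by
  constructor
  · intro hlq
    have hle := matSpecialUnitary_le_matUnitary (iterateFrobenius K p r) β
    refine essentialDim_eq_of_not_dvd_index (Subgroup.inclusion_injective hle) hl ?_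
    rw [Subgroup.inclusion_range]
    exact fun h => hlq (h.trans (relIndex_matSpecialUnitary_dvd hβ))
  · intro hl2 hlq
    refine essentialDim_eq_of_not_dvd_index (matSpecialUnitaryToSL_injective _ β) hl fun h => ?_
    exact not_dvd_index_matUnitary hK hl hl2 hlq hβ hβherm
      (h.trans (index_range_matSpecialUnitaryToSL_dvd _ β))

end

/-- Here `K` is the field with `q ^ 2` elements, `q = p ^ r`; its conjugation over the subfield
with `q` elements is `iterateFrobenius K p r : x ↦ x ^ (p ^ r)`; and `β` is any nondegenerate
Hermitian matrix. -/
theorem theorem10p1 (p r l n : ℕ) [Fact p.Prime] (hl : l.Prime) (hl2 : l ≠ 2) (hlp : l ≠ p)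
    (k : Type u) [Field k] (hk : ringChar k ≠ l)
    (K : Type v) [Field K] [Finite K] [CharP K p] (hK : Nat.card K = (p ^ r) ^ 2)
    (β : Matrix (Fin n) (Fin n) K) (hβ : IsUnit β.det)
    (hβherm : βᵀ = β.map (iterateFrobenius K p r)) :
    (¬ l ∣ p ^ r + 1 →
      essentialDim k (matSpecialUnitary (iterateFrobenius K p r) β) l =
        essentialDim k (matUnitary (iterateFrobenius K p r) β) l) ∧
    (l ∣ p ^ r + 1 →
      essentialDim k (matSpecialUnitary (iterateFrobenius K p r) β) l =
        essentialDim k (Matrix.SpecialLinearGroup (Fin n) K) l) := by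
  obtain ⟨h₁, h₂⟩ := theorem10p1_general p r l n hl k K hK β hβ hβherm
  exact ⟨h₁, h₂ hl2⟩
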